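/- Let $(\mathcal C,\mathbb E,\mathfrak s)$ be an extriangulated category in the sense of Nakaoka and Palu. A sequence $A\to B\to C$ that realizes some $\delta\in\mathbb E(C,A)$ is called an $\mathbb E$-triangle (with extension $\delta$). An object $P$ is *projective* if for every $\mathbb E$-triangle $A\to B\to C$ the sequence of abelian groups $0\to\mathcal C(P,A)\to\mathcal C(P,B)\to\mathcal C(P,C)\to 0$ is exact. An object $G$ is *Gorenstein projective* if there are a complex $\cdots\to P_1\xrightarrow{d_1}P_0\xrightarrow{d_0}P_{-1}\to\cdots$ of projective objects and $\mathbb E$-triangles $K_{i+1}\xrightarrow{g_i}P_i\xrightarrow{f_i}K_i$ with $d_i=g_{i-1}f_i$ for all $i\in\mathbb Z$ such that, for every projective $W$ and every $i$, the sequences $0\to\mathcal C(K_i,W)\to\mathcal C(P_i,W)\to\mathcal C(K_{i+1},W)\to0$ and $0\to\mathcal C(W,K_{i+1})\to\mathcal C(W,P_i)\to\mathcal C(W,K_i)\to0$ are exact, and $G\cong K_i$ for some $i$. The condition $\mathrm{Gpd}\,M\le n$ is defined inductively: $\mathrm{Gpd}\,M\le 0$ if $M$ is Gorenstein projective, and,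 for $n\ge1$, $\mathrm{Gpd}\,M\le n$ if there is an $\mathbb E$-triangle $N\to G\to M$ with $G$ Gorenstein projective and $\mathrm{Gpd}\,N\le n-1$. The dimension $\mathrm{Gpd}\,M\in\mathbb N\cup\{\infty\}$ is the least such $n$. A complex $0\to X_n\xrightarrow{d_n} X_{n-1}\to\cdots\xrightarrow{d_1} X_0\xrightarrow{\varepsilon} M\to0$ is *exact* if there are $\mathbb E$-triangles $K_1\xrightarrow{g_0} X_0\xrightarrow{\varepsilon} M$ and $K_{i+1}\xrightarrow{g_i} X_i\xrightarrow{f_i} K_i$ for $1\le i\le n$, with $K_{n+1}=0$ and $d_i=g_{i-1}f_i$ for $1\le i\le n$. **Theorem.** Let $M$ be an object of $\mathcal C$ and let $n\ge1$ be an integer. Then $\mathrm{Gpd}\,M\le n$ if and only if for every integer $s$ with $0\le s\le n$ there is an exact complex $$0\to X_n\to X_{n-1}\to\cdots\to X_1\to X_0\to M\to 0$$ in which $X_s$ is Gorenstein projective and $X_i$ is projective for every $i\ne s$ with $0\le i\le n$. -/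

import Mathlib

open CategoryTheory CategoryTheory.Limits Opposite

universe w v u

namespace Extri

section Extensions

variable {C : Type u} [Category.{v} C]

/-- The set `𝔼(Z, A)` of `𝔼`-extensions. -/
abbrev Ext (E : Cᵒᵖ ⥤ C ⥤ AddCommGrpCat.{w}) (Z A : C) : Type w :=
  (E.obj (op Z)).obj A

/-- `a_* δ = 𝔼(Z, a)(δ)`. -/
def push {E : Cᵒᵖ ⥤ C ⥤ AddCommGrpCat.{w}} {Z A A' : C} (a : A ⟶ A') (δ : Ext E Z A) :
    Ext E Z A' :=
  (E.obj (op Z)).map a δ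

/-- `c^* δ = 𝔼(c, A)(δ)`. -/
def pull {E : Cᵒᵖ ⥤ C ⥤ AddCommGrpCat.{w}} {Z Z' A : C} (c : Z' ⟶ Z) (δ : Ext E Z A) :
    Ext E Z' A :=
  (E.map c.op).app A δ

/-- `(a, c) : δ ⟶ δ'` is a morphism of `𝔼`-extensions: `a_* δ = c^* δ'`. -/
def IsExtHom {E : Cᵒᵖ ⥤ C ⥤ AddCommGrpCat.{w}} {A Z A' Z' : C}
    (δ : Ext E Z A) (δ' : Ext E Z' A') (a : A ⟶ A') (c : Z ⟶ Z') : Prop :=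
  push a δ = pull c δ'

/-- `δ ⊕ δ' ∈ 𝔼(Z ⊕ Z', A ⊕ A')`, the element with components `(δ, 0, 0, δ')`. -/
noncomputable def extSum [Preadditive C] [HasBinaryBiproducts C]
    {E : Cᵒᵖ ⥤ C ⥤ AddCommGrpCat.{w}} {A Z A' Z' : C}
    (δ : Ext E Z A) (δ' : Ext E Z' A') : Ext E (Z ⊞ Z') (A ⊞ A') :=
  push biprod.inl (pull biprod.fst δ) + push biprod.inr (pull biprod.snd δ')

end Extensions

/-- An extriangulated structure `(𝔼, 𝔰)` (in the sense of Nakaoka and Palu) on an additive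
category `C`.

The correspondence `𝔰`, which sends `δ ∈ 𝔼(Z, A)` to an equivalence class of sequences
`A ⟶ B ⟶ Z`, is encoded by the relation `Realizes x y δ`, read `𝔰(δ) = [A -x→ B -y→ Z]`:
`exists_realizes` and `realizes_iff` say that the sequences related to `δ` form exactly one
equivalence class. -/
structure ExtriangulatedStructure (C : Type u) [Category.{v} C] [Preadditive C]
    [HasZeroObject C] [HasBinaryBiproducts C] where
  /-- (ET1): the additive bifunctor `𝔼 : Cᵒᵖ × C ⟶ Ab`. -/
  E : Cᵒᵖ ⥤ C ⥤ AddCommGrpCat.{w}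
  additive_left : E.Additive
  additive_right : ∀ Z : Cᵒᵖ, (E.obj Z).Additive
  Realizes : ∀ {A B Z : C}, (A ⟶ B) → (B ⟶ Z) → Ext E Z A → Prop
  exists_realizes : ∀ {A Z : C} (δ : Ext E Z A),
    ∃ (B : C) (x : A ⟶ B) (y : B ⟶ Z), Realizes x y δ
  realizes_iff : ∀ {A B B' Z : C} {δ : Ext E Z A} {x : A ⟶ B} {y : B ⟶ Z}
    (x' : A ⟶ B') (y' : B' ⟶ Z), Realizes x y δ →
      (Realizes x' y' δ ↔ ∃ b : B ≅ B', x ≫ b.hom = x' ∧ b.hom ≫ y' = y)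
  /-- (ET2): `𝔰` is a realization of `𝔼`. -/
  realization : ∀ {A B Z A' B' Z' : C} {x : A ⟶ B} {y : B ⟶ Z} {δ : Ext E Z A}
    {x' : A' ⟶ B'} {y' : B' ⟶ Z'} {δ' : Ext E Z' A'},
    Realizes x y δ → Realizes x' y' δ' →
    ∀ (a : A ⟶ A') (c : Z ⟶ Z'), IsExtHom δ δ' a c →
      ∃ b : B ⟶ B', x ≫ b = a ≫ x' ∧ b ≫ y' = y ≫ c
  /-- (ET2): the realization is additive. -/
  realizes_zero : ∀ A Z : C,
    Realizes (biprod.inl : A ⟶ A ⊞ Z) (biprod.snd : A ⊞ Z ⟶ Z) (0 : Ext E Z A)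
  realizes_sum : ∀ {A B Z A' B' Z' : C} {x : A ⟶ B} {y : B ⟶ Z} {δ : Ext E Z A}
    {x' : A' ⟶ B'} {y' : B' ⟶ Z'} {δ' : Ext E Z' A'},
    Realizes x y δ → Realizes x' y' δ' →
      Realizes (biprod.map x x') (biprod.map y y') (extSum δ δ')
  /-- (ET3) -/
  et3 : ∀ {A B Z A' B' Z' : C} {x : A ⟶ B} {y : B ⟶ Z} {δ : Ext E Z A}
    {x' : A' ⟶ B'} {y' : B' ⟶ Z'} {δ' : Ext E Z' A'},
    Realizes x y δ → Realizes x' y' δ' →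
    ∀ (a : A ⟶ A') (b : B ⟶ B'), x ≫ b = a ≫ x' →
      ∃ c : Z ⟶ Z', IsExtHom δ δ' a c ∧ b ≫ y' = y ≫ c
  /-- (ET3)ᵒᵖ -/
  et3_op : ∀ {A B Z A' B' Z' : C} {x : A ⟶ B} {y : B ⟶ Z} {δ : Ext E Z A}
    {x' : A' ⟶ B'} {y' : B' ⟶ Z'} {δ' : Ext E Z' A'},
    Realizes x y δ → Realizes x' y' δ' →
    ∀ (b : B ⟶ B') (c : Z ⟶ Z'), b ≫ y' = y ≫ c →
      ∃ a : A ⟶ A', IsExtHom δ δ' a c ∧ x ≫ b = a ≫ x'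
  /-- (ET4) -/
  et4 : ∀ {A B D X F : C} {f : A ⟶ B} {f' : B ⟶ D} {δ : Ext E D A}
    {g : B ⟶ X} {g' : X ⟶ F} {δ' : Ext E F B},
    Realizes f f' δ → Realizes g g' δ' →
    ∃ (Y : C) (d : D ⟶ Y) (e : Y ⟶ F) (h : A ⟶ X) (h' : X ⟶ Y) (δ'' : Ext E Y A),
      h = f ≫ g ∧ g ≫ h' = f' ≫ d ∧ h' ≫ e = g' ∧
      Realizes h h' δ'' ∧
      Realizes d e (push f' δ') ∧
      pull d δ'' = δ ∧
      push f δ'' = pull e δ'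
  /-- (ET4)ᵒᵖ -/
  et4_op : ∀ {D A B F Z : C} {f' : D ⟶ A} {f : A ⟶ B} {δ : Ext E B D}
    {g' : F ⟶ B} {g : B ⟶ Z} {δ' : Ext E Z F},
    Realizes f' f δ → Realizes g' g δ' →
    ∃ (Y : C) (d : D ⟶ Y) (e : Y ⟶ F) (h' : Y ⟶ A) (h : A ⟶ Z) (δ'' : Ext E Z Y),
      h = f ≫ g ∧ h' ≫ f = e ≫ g' ∧ d ≫ h' = f' ∧
      Realizes h' h δ'' ∧
      Realizes d e (pull g' δ) ∧
      push e δ'' = δ' ∧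
      push d δ = pull g δ''

namespace ExtriangulatedStructure

variable {C : Type u} [Category.{v} C] [Preadditive C] [HasZeroObject C] [HasBinaryBiproducts C]
  (T : ExtriangulatedStructure.{w} C)

/-- `A -x→ B -y→ Z` is the underlying sequence of an `𝔼`-triangle. -/
def IsConflation {A B Z : C} (x : A ⟶ B) (y : B ⟶ Z) : Prop :=
  ∃ δ : Ext T.E Z A, T.Realizes x y δ

end ExtriangulatedStructure

section HomExact

variable {C : Type u} [Category.{v} C] [Preadditive C]

/-- `0 ⟶ C(W, A) ⟶ C(W, B) ⟶ C(W, Z) ⟶ 0` is exact. -/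
def IsHomExact (W : C) {A B Z : C} (x : A ⟶ B) (y : B ⟶ Z) : Prop :=
  Function.Injective (fun a : W ⟶ A => a ≫ x) ∧
  (∀ b : W ⟶ B, b ≫ y = 0 ↔ ∃ a : W ⟶ A, a ≫ x = b) ∧
  Function.Surjective (fun b : W ⟶ B => b ≫ y)

/-- `0 ⟶ C(Z, W) ⟶ C(B, W) ⟶ C(A, W) ⟶ 0` is exact. -/
def IsCoHomExact (W : C) {A B Z : C} (x : A ⟶ B) (y : B ⟶ Z) : Prop :=
  Function.Injective (fun c : Z ⟶ W => y ≫ c) ∧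
  (∀ b : B ⟶ W, x ≫ b = 0 ↔ ∃ c : Z ⟶ W, y ≫ c = b) ∧
  Function.Surjective (fun b : B ⟶ W => x ≫ b)

end HomExact

namespace ExtriangulatedStructure

variable {C : Type u} [Category.{v} C] [Preadditive C] [HasZeroObject C] [HasBinaryBiproducts C]
  (T : ExtriangulatedStructure.{w} C)

/-- Projective objects: `C(P, -)` turns every `𝔼`-triangle into a short exact sequence of abelian
groups (injectivity on the left included). -/
def IsProjective (P : C) : Prop :=
  ∀ ⦃A B Z : C⦄ (x : A ⟶ B) (y : B ⟶ Z), T.IsConflation x y → IsHomExact P x y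

/-- An exact unbounded complex `⋯ ⟶ X₁ ⟶ X₀ ⟶ X₋₁ ⟶ ⋯`, together with `𝔼`-triangles
`K (n + 1) ⟶ X n ⟶ K n` through which its differentials factor. -/
structure ExactComplex where
  X : ℤ → C
  d : ∀ n : ℤ, X (n + 1) ⟶ X n
  K : ℤ → C
  g : ∀ n : ℤ, K (n + 1) ⟶ X n
  f : ∀ n : ℤ, X n ⟶ K n
  conflation : ∀ n : ℤ, T.IsConflation (g n) (f n)
  d_eq : ∀ n : ℤ, d n = f (n + 1) ≫ g n

/-- A complete projective resolution: an exact complex of projective objects whose `𝔼`-triangles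
are `C(-, W)`-exact and `C(W, -)`-exact for all projective `W`. -/
def IsCompleteProjectiveResolution (P : T.ExactComplex) : Prop :=
  (∀ n, T.IsProjective (P.X n)) ∧
  (∀ W : C, T.IsProjective W → ∀ n, IsCoHomExact W (P.g n) (P.f n)) ∧
  (∀ W : C, T.IsProjective W → ∀ n, IsHomExact W (P.g n) (P.f n))

/-- Gorenstein projective objects: the objects `K n` of complete projective resolutions. -/
def IsGorensteinProjective (G : C) : Prop :=
  ∃ P : T.ExactComplex, T.IsCompleteProjectiveResolution P ∧ ∃ n : ℤ, Nonempty (P.K n ≅ G)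

/-- The inductive condition that defines `Gpd M ≤ n`. -/
def GpdLE : ℕ → C → Prop
  | 0, M => T.IsGorensteinProjective M
  | n + 1, M => ∃ (N G : C) (x : N ⟶ G) (y : G ⟶ M),
      T.IsConflation x y ∧ T.IsGorensteinProjective G ∧ GpdLE n N

/-- The Gorenstein projective dimension of `M` (`⊤` if no bound exists). -/
noncomputable def gpd (M : C) : ℕ∞ :=
  ⨅ (n : ℕ) (_ : T.GpdLE n M), (n : ℕ∞)

/-- An exact complex `0 ⟶ X n ⟶ X (n - 1) ⟶ ⋯ ⟶ X 1 ⟶ X 0 -ε→ M ⟶ 0`: there are `𝔼`-triangles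
`K 0 ⟶ X 0 -ε→ M` and `K (i + 1) ⟶ X (i + 1) ⟶ K i` through which the differentials factor, and
all `X i` with `i > n` and all `K i` with `i ≥ n` vanish. -/
structure FiniteExactComplex (n : ℕ) (M : C) where
  X : ℕ → C
  d : ∀ i : ℕ, X (i + 1) ⟶ X i
  ε : X 0 ⟶ M
  K : ℕ → C
  g : ∀ i : ℕ, K i ⟶ X i
  f : ∀ i : ℕ, X (i + 1) ⟶ K i
  conflation_zero : T.IsConflation (g 0) ε
  conflation_succ : ∀ i : ℕ, T.IsConflation (g (i + 1)) (f i)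
  d_eq : ∀ i : ℕ, d i = f i ≫ g i
  isZero_X : ∀ i : ℕ, n < i → IsZero (X i)
  isZero_K : ∀ i : ℕ, n ≤ i → IsZero (K i)

end ExtriangulatedStructure

end Extri

namespace Extri

/-! ### Functoriality of extension classes. -/

section Extensions

variable {C : Type u} [Category.{v} C] {E : Cᵒᵖ ⥤ C ⥤ AddCommGrpCat.{w}}

/-! The heart of the matter is that Gorenstein projectives are closed under extensions
(`IsGorensteinProjective.of_extension`). A complete resolution amounts to a chain of syzygy steps in
both directions, so it suffices that an extension of Gorenstein projectives has a syzygy and a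
cosyzygy of the same kind; two horseshoe constructions supply them. No enough-projectives hypothesis
is needed, since the end terms bring their own projectives.

For the forward implication (`GpdLE.exists_finiteExactComplex`), induct on `n` along a conflation `K
⟶ G ⟶ M`. To put the Gorenstein term in positive degree, cover `G` by a projective; the new kernel
is an extension of `K` by a Gorenstein projective, so its dimension does not grow. To put it in
degree zero, embed the head of a resolution of `K` into a projective and push out; the cokernel is
absorbed by `G`. The converse reads a bound off any one of the complexes. -/

@[simp]
lemma push_id {Z A : C} (δ : Ext E Z A) : push (𝟙 A) δ = δ := by
  simp [push]

@[simp]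
lemma pull_id {Z A : C} (δ : Ext E Z A) : pull (𝟙 Z) δ = δ := by
  simp [pull]

lemma push_comp {Z A A' A'' : C} (a : A ⟶ A') (a' : A' ⟶ A'') (δ : Ext E Z A) :
    push (a ≫ a') δ = push a' (push a δ) := by
  simp [push]

lemma pull_comp {Z Z' Z'' A : C} (c : Z' ⟶ Z) (c' : Z'' ⟶ Z') (δ : Ext E Z A) :
    pull (c' ≫ c) δ = pull c' (pull c δ) := by
  simp [pull]

lemma push_pull {Z Z' A A' : C} (a : A ⟶ A') (c : Z' ⟶ Z) (δ : Ext E Z A) :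
    push a (pull c δ) = pull c (push a δ) := by
  exact (NatTrans.naturality_apply (E.map c.op) a δ).symm

@[simp]
lemma push_zero {Z A A' : C} (a : A ⟶ A') : push a (0 : Ext E Z A) = 0 := by
  simp [push]

@[simp]
lemma pull_zero {Z Z' A : C} (c : Z' ⟶ Z) : pull c (0 : Ext E Z A) = 0 := by
  simp [pull]

lemma push_add {Z A A' : C} (a : A ⟶ A') (δ δ' : Ext E Z A) :
    push a (δ + δ') = push a δ + push a δ' := by
  simp [push]

lemma pull_add {Z Z' A : C} (c : Z' ⟶ Z) (δ δ' : Ext E Z A) :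
    pull c (δ + δ') = pull c δ + pull c δ' := by
  simp [pull]

end Extensions

namespace ExtriangulatedStructure

variable {C : Type u} [Category.{v} C] [Preadditive C] [HasZeroObject C] [HasBinaryBiproducts C]
  (T : ExtriangulatedStructure.{w} C)

lemma zero_push {Z A A' : C} (δ : Ext T.E Z A) : push (0 : A ⟶ A') δ = 0 := by
  have := T.additive_right (op Z)
  simp [push]

lemma zero_pull {Z Z' A : C} (δ : Ext T.E Z A) : pull (0 : Z' ⟶ Z) δ = 0 := by
  have := T.additive_left
  simp [pull]

lemma ext_eq_zero_of_isZero_left {Z A : C} (hZ : IsZero Z) (δ : Ext T.E Z A) : δ = 0 := by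
  rw [← pull_id δ, hZ.eq_of_src (𝟙 Z) 0, T.zero_pull]

lemma ext_eq_zero_of_isZero_right {Z A : C} (hA : IsZero A) (δ : Ext T.E Z A) : δ = 0 := by
  rw [← push_id δ, hA.eq_of_src (𝟙 A) 0, T.zero_push]

variable {T}

/-- The sequence `0 ⟶ Y ≅ Z`. -/
lemma realizes_iso_right {A Y Z : C} (hA : IsZero A) (e : Y ≅ Z) :
    T.Realizes (0 : A ⟶ Y) e.hom (0 : Ext T.E Z A) := by
  refine (T.realizes_iff _ _ (T.realizes_zero A Z)).2
    ⟨⟨biprod.snd ≫ e.inv, e.hom ≫ biprod.inr, ?_, by simp⟩, hA.eq_of_src _ _, by simp⟩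
  apply biprod.hom_ext'
  · exact hA.eq_of_src _ _
  · simp

/-- The sequence `A ≅ Y ⟶ 0`. -/
lemma realizes_iso_left {A Y Z : C} (hZ : IsZero Z) (e : A ≅ Y) :
    T.Realizes e.hom (0 : Y ⟶ Z) (0 : Ext T.E Z A) := by
  refine (T.realizes_iff _ _ (T.realizes_zero A Z)).2
    ⟨⟨biprod.fst ≫ e.hom, e.inv ≫ biprod.inl, ?_, by simp⟩, by simp, hZ.eq_of_tgt _ _⟩
  apply biprod.hom_ext
  · simp
  · exact hZ.eq_of_tgt _ _

/-! ### Exactness properties of a single conflation. -/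

section LongExact

variable {A B Z : C} {x : A ⟶ B} {y : B ⟶ Z} {δ : Ext T.E Z A}

lemma Realizes.comp_eq_zero (h : T.Realizes x y δ) : x ≫ y = 0 := by
  obtain ⟨c, -, hc⟩ := T.et3 (realizes_iso_left (isZero_zero C) (Iso.refl A)) h (𝟙 A) x (by simp)
  simpa using hc

lemma Realizes.exists_desc (h : T.Realizes x y δ) {W : C} (b : B ⟶ W) (hb : x ≫ b = 0) :
    ∃ c : Z ⟶ W, y ≫ c = b := by
  obtain ⟨c, -, hc⟩ := T.et3 h (realizes_iso_right (isZero_zero C) (Iso.refl W)) 0 b (by simp [hb])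
  exact ⟨c, by simpa using hc.symm⟩

lemma Realizes.exists_lift (h : T.Realizes x y δ) {W : C} (b : W ⟶ B) (hb : b ≫ y = 0) :
    ∃ a : W ⟶ A, a ≫ x = b := by
  obtain ⟨a, -, ha⟩ := T.et3_op (realizes_iso_left (isZero_zero C) (Iso.refl W)) h b 0 (by simp [hb])
  exact ⟨a, by simpa using ha.symm⟩

lemma Realizes.push_eq_zero (h : T.Realizes x y δ) : push x δ = 0 := by
  obtain ⟨c, hc, -⟩ := T.et3 h (realizes_iso_left (isZero_zero C) (Iso.refl B)) x (𝟙 B) (by simp)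
  rw [hc, pull_zero]

lemma Realizes.exists_extend (h : T.Realizes x y δ) {W : C} (a : A ⟶ W) (ha : push a δ = 0) :
    ∃ b : B ⟶ W, x ≫ b = a := by
  obtain ⟨b, hb, -⟩ := T.realization h (T.realizes_zero W Z) a (𝟙 Z) (by simp [IsExtHom, ha])
  exact ⟨b ≫ biprod.fst, by rw [← Category.assoc, hb]; simp⟩

lemma Realizes.eq_zero_of_section (h : T.Realizes x y δ) (s : Z ⟶ B) (hs : s ≫ y = 𝟙 Z) :
    δ = 0 := by
  obtain ⟨a, ha, -⟩ := T.et3_op (realizes_iso_right (isZero_zero C) (Iso.refl Z)) h s (𝟙 Z)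
    (by simp [hs])
  simpa [IsExtHom] using ha.symm

/-- Half-exactness of `𝔼(-, W)`: once the restriction of `θ` to `A` splits, (ET4)ᵒᵖ exhibits `θ` as
a pullback along `y` of a class in `𝔼(Z, W)`. -/
lemma Realizes.ext_eq_zero (h : T.Realizes x y δ) {W : C} (hA : ∀ θ : Ext T.E A W, θ = 0)
    (hZ : ∀ θ : Ext T.E Z W, θ = 0) (θ : Ext T.E B W) : θ = 0 := by
  obtain ⟨V, i, p, hV⟩ := T.exists_realizes θ
  obtain ⟨Y, d, e, -, -, δ'', -, -, -, -, hde, -, hd⟩ := T.et4_op hV h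
  obtain ⟨r, hr⟩ := hde.exists_extend (𝟙 W) (by rw [push_id]; exact hA _)
  rw [← push_id θ, ← hr, push_comp, hd, push_pull, hZ (push r δ''), pull_zero]

/-- The difference `b - 𝟙 B` factors both through `y` and through `x`, so it squares to zero because
`x ≫ y = 0`. Hence `b` is unipotent with inverse `2 - b`. -/
lemma Realizes.isIso_of_comp_eq (h : T.Realizes x y δ) (b : B ⟶ B) (hx : x ≫ b = x)
    (hy : b ≫ y = y) : IsIso b := by
  obtain ⟨s, hs⟩ := h.exists_desc (b - 𝟙 B) (by simp [hx])
  obtain ⟨r, hr⟩ := h.exists_lift (b - 𝟙 B) (by simp [hy])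
  have ht : (b - 𝟙 B) ≫ (b - 𝟙 B) = 0 := by
    nth_rewrite 1 [← hr]
    rw [← hs, Category.assoc, ← Category.assoc x, h.comp_eq_zero]
    simp
  have hb : b ≫ b = b + b - 𝟙 B := by
    simp only [Preadditive.sub_comp, Preadditive.comp_sub, Category.comp_id, Category.id_comp] at ht
    rw [← sub_eq_zero, ← ht]
    abel
  refine ⟨𝟙 B + 𝟙 B - b, ?_, ?_⟩ <;>
  · simp only [Preadditive.sub_comp, Preadditive.comp_sub, Preadditive.add_comp,
      Preadditive.comp_add, Category.comp_id, Category.id_comp, hb]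
    abel

/-- The axioms only give equivalences that fix the end terms. Here comparison maps in both
directions exist by (ET2), and their composites are invertible by `Realizes.isIso_of_comp_eq`. -/
lemma Realizes.of_iso (h : T.Realizes x y δ) {A' Z' : C} (a : A ≅ A') (c : Z ≅ Z') :
    T.Realizes (a.inv ≫ x) (y ≫ c.hom) (push a.hom (pull c.inv δ)) := by
  obtain ⟨B', x', y', h'⟩ := T.exists_realizes (push a.hom (pull c.inv δ))
  obtain ⟨b, hb₁, hb₂⟩ := T.realization h h' a.hom c.hom (by
    rw [IsExtHom, push_pull, ← pull_comp, c.hom_inv_id, pull_id])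
  obtain ⟨b', hb'₁, hb'₂⟩ := T.realization h' h a.inv c.inv (by
    rw [IsExtHom, ← push_comp, a.hom_inv_id, push_id])
  have : IsIso (b ≫ b') := h.isIso_of_comp_eq _
    (by rw [← Category.assoc, hb₁, Category.assoc, hb'₁, a.hom_inv_id_assoc])
    (by rw [Category.assoc, hb'₂, ← Category.assoc, hb₂, Category.assoc, c.hom_inv_id,
      Category.comp_id])
  have : IsIso (b' ≫ b) := h'.isIso_of_comp_eq _
    (by rw [← Category.assoc, hb'₁, Category.assoc, hb₁, a.inv_hom_id_assoc])
    (by rw [Category.assoc, hb₂, ← Category.assoc, hb'₂, Category.assoc, c.inv_hom_id,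
      Category.comp_id])
  have : Mono b := mono_of_mono b b'
  have : IsSplitEpi b := ⟨⟨inv (b' ≫ b) ≫ b', by simp⟩⟩
  have : IsIso b := isIso_of_mono_of_isSplitEpi b
  refine (T.realizes_iff _ _ h').2 ⟨(asIso b).symm, ?_, ?_⟩
  · rw [Iso.symm_hom, asIso_inv, IsIso.comp_inv_eq, Category.assoc, hb₁, a.inv_hom_id_assoc]
  · rw [Iso.symm_hom, asIso_inv, IsIso.inv_comp_eq, hb₂]

lemma Realizes.nonempty_iso_of_isZero (h : T.Realizes x y δ) (hA : IsZero A) :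
    Nonempty (B ≅ Z) := by
  obtain rfl := T.ext_eq_zero_of_isZero_right hA δ
  obtain ⟨b, -, -⟩ := (T.realizes_iff _ _ (realizes_iso_right hA (Iso.refl Z))).1 h
  exact ⟨b.symm⟩

end LongExact

/-! ### Pullbacks and pushouts of conflations. -/

variable (T) in
lemma realizes_zero_swap (A Z : C) :
    T.Realizes (biprod.inr : A ⟶ Z ⊞ A) (biprod.fst : Z ⊞ A ⟶ Z) (0 : Ext T.E Z A) :=
  (T.realizes_iff _ _ (T.realizes_zero A Z)).2
    ⟨biprod.braiding A Z, by ext <;> simp, by simp⟩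

/-- The common middle term `V` realizes the class `(δ₁, δ₂)` in `𝔼(Z, A₁ ⊞ A₂)`; (ET4) divides out
one summand at a time. -/
lemma realizes_pullback {A₁ B₁ A₂ B₂ Z : C} {x₁ : A₁ ⟶ B₁} {y₁ : B₁ ⟶ Z} {δ₁ : Ext T.E Z A₁}
    {x₂ : A₂ ⟶ B₂} {y₂ : B₂ ⟶ Z} {δ₂ : Ext T.E Z A₂}
    (h₁ : T.Realizes x₁ y₁ δ₁) (h₂ : T.Realizes x₂ y₂ δ₂) :
    ∃ (V : C) (m₁ : A₁ ⟶ V) (e₂ : V ⟶ B₂) (m₂ : A₂ ⟶ V) (e₁ : V ⟶ B₁),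
      T.Realizes m₁ e₂ (pull y₂ δ₁) ∧ T.Realizes m₂ e₁ (pull y₁ δ₂) ∧
      m₁ ≫ e₁ = x₁ ∧ m₂ ≫ e₂ = x₂ ∧ e₁ ≫ y₁ = e₂ ≫ y₂ := by
  obtain ⟨V, g, g', hV⟩ := T.exists_realizes
    (push (biprod.inl : A₁ ⟶ A₁ ⊞ A₂) δ₁ + push (biprod.inr : A₂ ⟶ A₁ ⊞ A₂) δ₂)
  -- The split sequence on `A₁ ⊞ A₂` is kept abstract, so that one argument serves both summands.
  have key : ∀ {A A' B' : C} {δ : Ext T.E Z A} {x' : A' ⟶ B'} {y' : B' ⟶ Z} {δ' : Ext T.E Z A'}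
      (i : A ⟶ A₁ ⊞ A₂) (p' : A₁ ⊞ A₂ ⟶ A') (i' : A' ⟶ A₁ ⊞ A₂) (p : A₁ ⊞ A₂ ⟶ A),
      T.Realizes i p' (0 : Ext T.E A' A) → i ≫ p = 𝟙 A → i' ≫ p' = 𝟙 A' →
      push p (push (biprod.inl : A₁ ⟶ A₁ ⊞ A₂) δ₁ + push (biprod.inr : A₂ ⟶ A₁ ⊞ A₂) δ₂) = δ →
      push p' (push (biprod.inl : A₁ ⟶ A₁ ⊞ A₂) δ₁ + push (biprod.inr : A₂ ⟶ A₁ ⊞ A₂) δ₂) = δ' →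
      T.Realizes x' y' δ' →
      ∃ e : V ⟶ B', T.Realizes (i ≫ g) e (pull y' δ) ∧ i' ≫ g ≫ e = x' ∧ e ≫ y' = g' := by
    intro A A' B' δ x' y' δ' i p' i' p hs hip hip' hδ hδ' h'
    obtain ⟨Y, d, e, _, k, δ'', rfl, hk₁, hk₂, hk, hde, -, hpush⟩ := T.et4 hs hV
    rw [hδ'] at hde
    obtain ⟨b, hb₁, hb₂⟩ := (T.realizes_iff _ _ hde).1 h'
    have hδ'' : δ'' = pull e δ := by
      rw [← hδ, ← push_pull, ← hpush, ← push_comp, hip, push_id]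
    have := hk.of_iso (Iso.refl A) b
    refine ⟨k ≫ b.hom, ?_, ?_, ?_⟩
    · rw [hδ'', Iso.refl_hom, push_id, ← pull_comp, ← hb₂, b.inv_hom_id_assoc] at this
      simpa using this
    · rw [reassoc_of% hk₁, reassoc_of% hip', hb₁]
    · rw [Category.assoc, hb₂, hk₂]
  obtain ⟨e₂, he₂, hm₂, hy₂⟩ := key (δ := δ₁) biprod.inl biprod.snd biprod.inr biprod.fst
    (T.realizes_zero A₁ A₂) (by simp) (by simp)
    (by simp [push_add, ← push_comp, T.zero_push]) (by simp [push_add, ← push_comp, T.zero_push]) h₂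
  obtain ⟨e₁, he₁, hm₁, hy₁⟩ := key (δ := δ₂) biprod.inr biprod.fst biprod.inl biprod.snd
    (T.realizes_zero_swap A₂ A₁) (by simp) (by simp)
    (by simp [push_add, ← push_comp, T.zero_push]) (by simp [push_add, ← push_comp, T.zero_push]) h₁
  exact ⟨V, biprod.inl ≫ g, e₂, biprod.inr ≫ g, e₁, he₂, he₁, by simpa using hm₁,
    by simpa using hm₂, hy₁.trans hy₂.symm⟩

lemma realizes_pushout {A B₁ Z₁ B₂ Z₂ : C} {x₁ : A ⟶ B₁} {y₁ : B₁ ⟶ Z₁} {δ₁ : Ext T.E Z₁ A}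
    {x₂ : A ⟶ B₂} {y₂ : B₂ ⟶ Z₂} {δ₂ : Ext T.E Z₂ A}
    (h₁ : T.Realizes x₁ y₁ δ₁) (h₂ : T.Realizes x₂ y₂ δ₂) :
    ∃ (V : C) (m₁ : B₁ ⟶ V) (e₂ : V ⟶ Z₂) (m₂ : B₂ ⟶ V) (e₁ : V ⟶ Z₁),
      T.Realizes m₁ e₂ (push x₁ δ₂) ∧ T.Realizes m₂ e₁ (push x₂ δ₁) ∧
      m₁ ≫ e₁ = y₁ ∧ m₂ ≫ e₂ = y₂ ∧ x₁ ≫ m₁ = x₂ ≫ m₂ := by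
  obtain ⟨V, g', g, hV⟩ := T.exists_realizes
    (pull (biprod.fst : Z₁ ⊞ Z₂ ⟶ Z₁) δ₁ + pull (biprod.snd : Z₁ ⊞ Z₂ ⟶ Z₂) δ₂)
  have key : ∀ {Z Z' B' : C} {δ : Ext T.E Z A} {x' : A ⟶ B'} {y' : B' ⟶ Z'} {δ' : Ext T.E Z' A}
      (p : Z₁ ⊞ Z₂ ⟶ Z) (i' : Z' ⟶ Z₁ ⊞ Z₂) (p' : Z₁ ⊞ Z₂ ⟶ Z') (i : Z ⟶ Z₁ ⊞ Z₂),
      T.Realizes i' p (0 : Ext T.E Z Z') → i ≫ p = 𝟙 Z → i' ≫ p' = 𝟙 Z' →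
      pull i (pull (biprod.fst : Z₁ ⊞ Z₂ ⟶ Z₁) δ₁ + pull (biprod.snd : Z₁ ⊞ Z₂ ⟶ Z₂) δ₂) = δ →
      pull i' (pull (biprod.fst : Z₁ ⊞ Z₂ ⟶ Z₁) δ₁ + pull (biprod.snd : Z₁ ⊞ Z₂ ⟶ Z₂) δ₂) = δ' →
      T.Realizes x' y' δ' →
      ∃ m : B' ⟶ V, T.Realizes m (g ≫ p) (push x' δ) ∧ m ≫ g ≫ p' = y' ∧ x' ≫ m = g' := by
    intro Z Z' B' δ x' y' δ' p i' p' i hs hip hip' hδ hδ' h'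
    obtain ⟨Y, d, e, k, _, δ'', rfl, hk₁, hk₂, hk, hde, -, hpush⟩ := T.et4_op hV hs
    rw [hδ'] at hde
    obtain ⟨b, hb₁, hb₂⟩ := (T.realizes_iff _ _ hde).1 h'
    have hδ'' : δ'' = push d δ := by
      rw [← hδ, push_pull, hpush, ← pull_comp, hip, pull_id]
    have := hk.of_iso b (Iso.refl Z)
    refine ⟨b.inv ≫ k, ?_, ?_, ?_⟩
    · rw [hδ'', Iso.refl_inv, pull_id, ← push_comp, hb₁] at this
      simpa using this
    · rw [Category.assoc, reassoc_of% hk₁, hip', Category.comp_id, ← hb₂, b.inv_hom_id_assoc]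
    · rw [← hb₁, Category.assoc, b.hom_inv_id_assoc, hk₂]
  obtain ⟨m₁, hr₁, hm₁, hx₁⟩ := key (δ := δ₂) biprod.snd biprod.inl biprod.fst biprod.inr
    (T.realizes_zero Z₁ Z₂) (by simp) (by simp)
    (by simp [pull_add, ← pull_comp, T.zero_pull]) (by simp [pull_add, ← pull_comp, T.zero_pull]) h₁
  obtain ⟨m₂, hr₂, hm₂, hx₂⟩ := key (δ := δ₁) biprod.fst biprod.inr biprod.snd biprod.inl
    (T.realizes_zero_swap Z₂ Z₁) (by simp) (by simp)
    (by simp [pull_add, ← pull_comp, T.zero_pull]) (by simp [pull_add, ← pull_comp, T.zero_pull]) h₂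
  exact ⟨V, m₁, g ≫ biprod.snd, m₂, g ≫ biprod.fst, hr₁, hr₂, hm₁, hm₂, hx₁.trans hx₂.symm⟩

end ExtriangulatedStructure

end Extri

/-! ### Projectives and syzygies. -/

namespace Extri

namespace ExtriangulatedStructure

open scoped ZeroObject

variable {C : Type u} [Category.{v} C] [Preadditive C] [HasZeroObject C] [HasBinaryBiproducts C]
  {T : ExtriangulatedStructure.{w} C}

lemma isProjective_of_injective_of_surjective {P : C}
    (hi : ∀ ⦃A B Z : C⦄ (x : A ⟶ B) (y : B ⟶ Z), T.IsConflation x y →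
      ∀ a : P ⟶ A, a ≫ x = 0 → a = 0)
    (hs : ∀ ⦃A B Z : C⦄ (x : A ⟶ B) (y : B ⟶ Z), T.IsConflation x y →
      ∀ c : P ⟶ Z, ∃ b : P ⟶ B, b ≫ y = c) : T.IsProjective P := by
  rintro A B Z x y ⟨δ, h⟩
  refine ⟨fun a a' haa => ?_, fun b => ⟨h.exists_lift b, ?_⟩, fun c => hs x y ⟨δ, h⟩ c⟩
  · rw [← sub_eq_zero]
    exact hi x y ⟨δ, h⟩ _ (by simpa [sub_eq_zero] using haa)
  · rintro ⟨a, rfl⟩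
    simp [h.comp_eq_zero]

lemma IsProjective.eq_zero {P A B Z : C} (hP : T.IsProjective P) {x : A ⟶ B} {y : B ⟶ Z}
    (h : T.IsConflation x y) (a : P ⟶ A) (ha : a ≫ x = 0) : a = 0 :=
  (hP x y h).1 (by simpa using ha)

lemma IsProjective.exists_lift {P A B Z : C} (hP : T.IsProjective P) {x : A ⟶ B} {y : B ⟶ Z}
    (h : T.IsConflation x y) (c : P ⟶ Z) : ∃ b : P ⟶ B, b ≫ y = c :=
  (hP x y h).2.2 c

lemma IsProjective.of_isZero {P : C} (hP : IsZero P) : T.IsProjective P :=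
  isProjective_of_injective_of_surjective (fun _ _ _ _ _ _ _ _ => hP.eq_of_src _ _)
    (fun _ _ _ _ _ _ _ => ⟨0, hP.eq_of_src _ _⟩)

lemma IsProjective.biprod {P Q : C} (hP : T.IsProjective P) (hQ : T.IsProjective Q) :
    T.IsProjective (P ⊞ Q) := by
  refine isProjective_of_injective_of_surjective (fun A B Z x y h a ha => ?_)
    (fun A B Z x y h c => ?_)
  · apply biprod.hom_ext'
    · rw [hP.eq_zero h (biprod.inl ≫ a) (by simp [ha]), comp_zero]
    · rw [hQ.eq_zero h (biprod.inr ≫ a) (by simp [ha]), comp_zero]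
  · obtain ⟨b, hb⟩ := hP.exists_lift h (biprod.inl ≫ c)
    obtain ⟨b', hb'⟩ := hQ.exists_lift h (biprod.inr ≫ c)
    exact ⟨biprod.desc b b', by ext <;> simp [hb, hb']⟩

lemma IsProjective.ext_eq_zero {P W : C} (hP : T.IsProjective P) (θ : Ext T.E P W) : θ = 0 := by
  obtain ⟨V, i, p, h⟩ := T.exists_realizes θ
  obtain ⟨s, hs⟩ := hP.exists_lift ⟨θ, h⟩ (𝟙 P)
  exact h.eq_zero_of_section s hs

variable (T) in
/-- `p` is right cancellable by maps into projective objects. -/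
def IsProjEpi {B Z : C} (p : B ⟶ Z) : Prop :=
  ∀ ⦃W : C⦄, T.IsProjective W → ∀ c : Z ⟶ W, p ≫ c = 0 → c = 0

variable (T) in
/-- `𝔼(G, W) = 0` for all projective `W`. -/
def IsExtOrthogonal (G : C) : Prop :=
  ∀ ⦃W : C⦄, T.IsProjective W → ∀ θ : Ext T.E G W, θ = 0

variable (T) in
/-- `K` is the first syzygy of `G` by a projective object, in a `C(-, W)`-exact way for all
projective `W`. -/
def IsSyzygy (K G : C) : Prop :=
  ∃ (P : C) (g : K ⟶ P) (f : P ⟶ G), T.IsProjective P ∧ T.IsConflation g f ∧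
    ∀ W : C, T.IsProjective W → IsCoHomExact W g f

/-- Middle exactness of `C(-, W)` is automatic and surjectivity follows from `𝔼(G, W) = 0`, so only
injectivity has to be assumed. -/
lemma isSyzygy_of_realizes {K P G : C} {g : K ⟶ P} {f : P ⟶ G} {δ : Ext T.E G K}
    (hP : T.IsProjective P) (h : T.Realizes g f δ) (hf : T.IsProjEpi f)
    (hG : T.IsExtOrthogonal G) : T.IsSyzygy K G := by
  refine ⟨P, g, f, hP, ⟨δ, h⟩, fun W hW => ⟨fun c c' hcc => ?_, fun b => ⟨h.exists_desc b, ?_⟩,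
    fun a => h.exists_extend a (hG hW _)⟩⟩
  · rw [← sub_eq_zero]
    exact hf hW _ (by simpa [sub_eq_zero] using hcc)
  · rintro ⟨c, rfl⟩
    rw [← Category.assoc, h.comp_eq_zero, zero_comp]

lemma IsSyzygy.exists_realizes {K G : C} (h : T.IsSyzygy K G) :
    ∃ (P : C) (g : K ⟶ P) (f : P ⟶ G) (δ : Ext T.E G K), T.IsProjective P ∧
      T.Realizes g f δ ∧ T.IsProjEpi f := by
  obtain ⟨P, g, f, hP, ⟨δ, hδ⟩, hW⟩ := h
  exact ⟨P, g, f, δ, hP, hδ, fun W hWp c hc => (hW W hWp).1 (by simpa using hc)⟩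

/-- Since `P` is projective, every class in `𝔼(G, W)` is a pushout of `δ` along some `K ⟶ W`. That
map extends over `g`, and `g` kills `δ`. -/
lemma IsSyzygy.isExtOrthogonal {K G : C} (h : T.IsSyzygy K G) : T.IsExtOrthogonal G := by
  intro W hW θ
  obtain ⟨P, g, f, hP, ⟨δ, hδ⟩, hco⟩ := h
  obtain ⟨V, i, p, hV⟩ := T.exists_realizes θ
  obtain ⟨q, hq⟩ := hP.exists_lift ⟨θ, hV⟩ f
  obtain ⟨a, ha, -⟩ := T.et3_op hδ hV q (𝟙 G) (by simp [hq])
  obtain ⟨b, rfl⟩ := (hco W hW).2.2 a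
  rw [IsExtHom, push_comp, hδ.push_eq_zero, push_zero, pull_id] at ha
  exact ha.symm

lemma IsSyzygy.of_iso {K G K' G' : C} (h : T.IsSyzygy K G) (a : K ≅ K') (c : G ≅ G') :
    T.IsSyzygy K' G' := by
  obtain ⟨P, g, f, δ, hP, hδ, hf⟩ := h.exists_realizes
  refine isSyzygy_of_realizes hP (hδ.of_iso a c) (fun W hW t ht => ?_) (fun W hW θ => ?_)
  · have := hf hW (c.hom ≫ t) (by simpa using ht)
    rwa [← cancel_epi c.hom, comp_zero]
  · rw [← pull_id θ, ← c.inv_hom_id, pull_comp, h.isExtOrthogonal hW (pull c.hom θ), pull_zero]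

end ExtriangulatedStructure

lemma exists_int_chain {α : Type*} {p : α → Prop} {R : α → α → Prop}
    (hl : ∀ a, p a → ∃ b, p b ∧ R b a) (hr : ∀ a, p a → ∃ b, p b ∧ R a b) {a : α} (ha : p a) :
    ∃ K : ℤ → α, K 0 = a ∧ ∀ n, R (K (n + 1)) (K n) := by
  choose! l hlp hlR using hl
  choose! r hrp hrR using hr
  have hL : ∀ n : ℕ, p (l^[n] a) := fun n => by
    induction n with
    | zero => exact ha
    | succ n ih => rw [Function.iterate_succ_apply']; exact hlp _ ih
  have hR : ∀ n : ℕ, p (r^[n] a) := fun n => by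
    induction n with
    | zero => exact ha
    | succ n ih => rw [Function.iterate_succ_apply']; exact hrp _ ih
  refine ⟨fun n => if 0 ≤ n then l^[n.toNat] a else r^[(-n).toNat] a, by simp, fun n => ?_⟩
  obtain ⟨m, rfl | rfl⟩ : ∃ m : ℕ, n = m ∨ n = -(m + 1 : ℕ) := by
    rcases lt_or_ge n 0 with h | h
    · exact ⟨(-n - 1).toNat, Or.inr (by omega)⟩
    · exact ⟨n.toNat, Or.inl (by omega)⟩
  · have h₁ : (0 : ℤ) ≤ m + 1 := by omega
    have h₂ : ((m : ℤ) + 1).toNat = m + 1 := by omega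
    simp only [if_pos h₁, h₂, if_pos (Int.natCast_nonneg m), Int.toNat_natCast,
      Function.iterate_succ_apply']
    exact hlR _ (hL m)
  · have h₂ : ¬ (0 : ℤ) ≤ -(m + 1 : ℕ) := by omega
    have h₃ : (-(-(m + 1 : ℕ) : ℤ)).toNat = m + 1 := by omega
    simp only [if_neg h₂, h₃, Function.iterate_succ_apply']
    have key := hrR _ (hR m)
    -- Index `0` belongs to the other branch of the `if`, so the link across it is separate.
    cases m with
    | zero => simpa using key
    | succ k =>
      have h₄ : ¬ (0 : ℤ) ≤ -(k + 1 + 1 : ℕ) + 1 := by omega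
      have h₅ : (-(-(k + 1 + 1 : ℕ) + 1 : ℤ)).toNat = k + 1 := by omega
      rw [if_neg h₄, h₅]
      exact key

/-! ### Gorenstein projectives and closure under extensions. -/

namespace ExtriangulatedStructure

open scoped ZeroObject

variable {C : Type u} [Category.{v} C] [Preadditive C] [HasZeroObject C] [HasBinaryBiproducts C]
  {T : ExtriangulatedStructure.{w} C}

/-- Reduces the construction of an unbounded resolution to one step in each direction. Covariant
exactness comes for free from the definition of projective. -/
lemma isGorensteinProjective_of_syzygies {p : C → Prop}
    (hl : ∀ G, p G → ∃ K, p K ∧ T.IsSyzygy K G) (hr : ∀ G, p G → ∃ K, p K ∧ T.IsSyzygy G K)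
    {G : C} (hG : p G) : T.IsGorensteinProjective G := by
  obtain ⟨K, hK, hs⟩ := exists_int_chain hl hr hG
  choose P g f hP hc hW using hs
  exact ⟨⟨P, fun n => f (n + 1) ≫ g n, K, g, f, hc, fun _ => rfl⟩,
    ⟨hP, fun W h n => hW n W h, fun W h n => h _ _ (hc n)⟩, 0, ⟨eqToIso hK⟩⟩

lemma IsGorensteinProjective.exists_syzygy {G : C} (hG : T.IsGorensteinProjective G) :
    ∃ K, T.IsGorensteinProjective K ∧ T.IsSyzygy K G := by
  obtain ⟨P, hP, n, ⟨e⟩⟩ := hG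
  exact ⟨P.K (n + 1), ⟨P, hP, n + 1, ⟨Iso.refl _⟩⟩, IsSyzygy.of_iso
    ⟨_, _, _, hP.1 n, P.conflation n, fun W hW => hP.2.1 W hW n⟩ (Iso.refl _) e⟩

lemma IsGorensteinProjective.exists_cosyzygy {G : C} (hG : T.IsGorensteinProjective G) :
    ∃ K, T.IsGorensteinProjective K ∧ T.IsSyzygy G K := by
  obtain ⟨P, hP, n, ⟨e⟩⟩ := hG
  obtain ⟨n, rfl⟩ : ∃ m, n = m + 1 := ⟨n - 1, by omega⟩
  exact ⟨P.K n, ⟨P, hP, n, ⟨Iso.refl _⟩⟩, IsSyzygy.of_iso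
    ⟨_, _, _, hP.1 n, P.conflation n, fun W hW => hP.2.1 W hW n⟩ e (Iso.refl _)⟩

lemma IsGorensteinProjective.of_iso {G G' : C} (hG : T.IsGorensteinProjective G) (e : G ≅ G') :
    T.IsGorensteinProjective G' := by
  obtain ⟨P, hP, n, ⟨e'⟩⟩ := hG
  exact ⟨P, hP, n, ⟨e' ≪≫ e⟩⟩

lemma IsProjective.isGorensteinProjective {P : C} (hP : T.IsProjective P) :
    T.IsGorensteinProjective P := by
  refine isGorensteinProjective_of_syzygies (p := T.IsProjective) (fun P hP => ?_) (fun P hP => ?_)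
    hP
  · exact ⟨0, .of_isZero (isZero_zero C), isSyzygy_of_realizes hP
      (realizes_iso_right (isZero_zero C) (Iso.refl P)) (fun _ _ c hc => by simpa using hc)
      fun _ _ θ => hP.ext_eq_zero θ⟩
  · exact ⟨0, .of_isZero (isZero_zero C), isSyzygy_of_realizes hP
      (realizes_iso_left (isZero_zero C) (Iso.refl P))
      (fun _ _ c _ => (isZero_zero C).eq_of_src c 0)
      fun _ _ θ => T.ext_eq_zero_of_isZero_left (isZero_zero C) θ⟩

/-- Horseshoe: the pullback of `y` along `Q ⟶ Z` splits as `A ⊞ Q`, which `P ⊞ Q` covers; (ET4)ᵒᵖ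
composes the two deflations onto `B`. -/
lemma exists_syzygy_of_extension {A B Z A₁ Z₁ : C} {x : A ⟶ B} {y : B ⟶ Z} {δ : Ext T.E Z A}
    (h : T.Realizes x y δ) (hA : T.IsSyzygy A₁ A) (hZ : T.IsSyzygy Z₁ Z) :
    ∃ (A' B' : C) (x' : A' ⟶ B') (y' : B' ⟶ Z₁), Nonempty (A₁ ≅ A') ∧ T.IsConflation x' y' ∧
      T.IsSyzygy B' B := by
  obtain ⟨P, gP, fP, δP, hP, hrP, hfP⟩ := hA.exists_realizes
  obtain ⟨Q, gQ, fQ, δQ, hQ, hrQ, hfQ⟩ := hZ.exists_realizes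
  obtain ⟨V, m₁, e₂, m₂, e₁, hV₁, hV₂, hme₁, -, hsq⟩ := realizes_pullback h hrQ
  rw [hQ.ext_eq_zero (pull fQ δ)] at hV₁
  obtain ⟨s, hs⟩ := hQ.exists_lift ⟨_, hV₁⟩ (𝟙 Q)
  obtain ⟨b, hb₁, hb₂⟩ := (T.realizes_iff _ _ (T.realizes_zero A Q)).1 hV₁
  have hPQ := T.realizes_sum hrP (realizes_iso_right (isZero_zero C) (Iso.refl Q))
  have hPV := hPQ.of_iso (Iso.refl _) b
  obtain ⟨Y, d, e, k, _, δ'', rfl, hk₁, hk₂, hk, hde, -, -⟩ := T.et4_op hPV hV₂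
  refine ⟨_, Y, d, e, ⟨⟨biprod.inl, biprod.fst, by simp, ?_⟩⟩, ⟨_, hde⟩, isSyzygy_of_realizes
    (hP.biprod hQ) hk (fun W hW c hc => ?_) (fun W hW θ =>
      h.ext_eq_zero (hA.isExtOrthogonal hW) (hZ.isExtOrthogonal hW) θ)⟩
  · apply biprod.hom_ext
    · simp
    · exact (isZero_zero C).eq_of_tgt _ _
  · have hc₁ : x ≫ c = 0 := by
      apply hfP hW
      simpa [reassoc_of% hb₁, reassoc_of% hme₁] using biprod.inl ≫= hc
    have hc₂ : e₁ ≫ c = 0 := by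
      rw [← cancel_epi b.hom]
      apply biprod.hom_ext'
      · simp [reassoc_of% hb₁, reassoc_of% hme₁, hc₁]
      · simpa using biprod.inr ≫= hc
    obtain ⟨c', rfl⟩ := h.exists_desc c hc₁
    have : fQ ≫ c' = 0 := by
      rw [← Category.id_comp fQ, ← hs, Category.assoc, Category.assoc, ← reassoc_of% hsq, hc₂,
        comp_zero]
    rw [hfQ hW c' this, comp_zero]

/-- The dual horseshoe. `P` need not be injective, so the pushout along `A ⟶ P` splits because `Z`
is orthogonal to projectives. -/
lemma exists_cosyzygy_of_extension {A B Z A₁ Z₁ : C} {x : A ⟶ B} {y : B ⟶ Z} {δ : Ext T.E Z A}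
    (h : T.Realizes x y δ) (hA : T.IsSyzygy A A₁) (hZ : T.IsSyzygy Z Z₁)
    (hA₁ : T.IsExtOrthogonal A₁) (hZo : T.IsExtOrthogonal Z) :
    ∃ (B' Z' : C) (x' : A₁ ⟶ B') (y' : B' ⟶ Z'), Nonempty (Z₁ ≅ Z') ∧ T.IsConflation x' y' ∧
      T.IsSyzygy B B' := by
  obtain ⟨P, gP, fP, δP, hP, hrP, hfP⟩ := hA.exists_realizes
  obtain ⟨Q, gQ, fQ, δQ, hQ, hrQ, hfQ⟩ := hZ.exists_realizes
  obtain ⟨V, m₁, e₂, m₂, e₁, hV₁, hV₂, -, hme₂, -⟩ := realizes_pushout h hrP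
  rw [hZo hP (push gP δ)] at hV₂
  obtain ⟨b, hb₁, hb₂⟩ := (T.realizes_iff _ _ (T.realizes_zero P Z)).1 hV₂
  have hPQ := T.realizes_sum (realizes_iso_left (isZero_zero C) (Iso.refl P)) hrQ
  have hVQ := hPQ.of_iso b (Iso.refl _)
  obtain ⟨Y, d, e, _, k, δ'', rfl, hk₁, hk₂, hk, hde, -, -⟩ := T.et4 hV₁ hVQ
  have hZ' : Z₁ ≅ (0 : C) ⊞ Z₁ := ⟨biprod.inr, biprod.snd, by simp, by
    apply biprod.hom_ext
    · exact (isZero_zero C).eq_of_tgt _ _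
    · simp⟩
  refine ⟨Y, _, d, e, ⟨hZ'⟩, ⟨_, hde⟩, isSyzygy_of_realizes
    (hP.biprod hQ) hk (fun W hW c hc => ?_) (fun W hW θ => hde.ext_eq_zero (hA₁ hW)
      ((hZ.of_iso (Iso.refl _) hZ').isExtOrthogonal hW) θ)⟩
  have hc₁ : d ≫ c = 0 := by
    apply hfP hW
    rw [← hme₂, Category.assoc, ← reassoc_of% hk₁, hc, comp_zero,
      comp_zero, comp_zero]
  obtain ⟨c', rfl⟩ := hde.exists_desc c hc₁
  rw [reassoc_of% hk₂] at hc
  have : c' = 0 := by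
    apply biprod.hom_ext'
    · exact (isZero_zero C).eq_of_src _ _
    · rw [comp_zero]
      apply hfQ hW
      simpa using biprod.inr ≫= hc
  rw [this, comp_zero]

lemma IsGorensteinProjective.of_extension {A B Z : C} {x : A ⟶ B} {y : B ⟶ Z}
    (h : T.IsConflation x y) (hA : T.IsGorensteinProjective A)
    (hZ : T.IsGorensteinProjective Z) : T.IsGorensteinProjective B := by
  refine isGorensteinProjective_of_syzygies (p := fun B => ∃ (A Z : C) (x : A ⟶ B) (y : B ⟶ Z),
    T.IsGorensteinProjective A ∧ T.IsGorensteinProjective Z ∧ T.IsConflation x y) ?_ ?_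
    ⟨A, Z, x, y, hA, hZ, h⟩
  · rintro B ⟨A, Z, x, y, hA, hZ, δ, h⟩
    obtain ⟨A₁, hA₁, hsA⟩ := hA.exists_syzygy
    obtain ⟨Z₁, hZ₁, hsZ⟩ := hZ.exists_syzygy
    obtain ⟨A', B', x', y', ⟨i⟩, hc, hs⟩ := exists_syzygy_of_extension h hsA hsZ
    exact ⟨B', ⟨A', Z₁, x', y', hA₁.of_iso i, hZ₁, hc⟩, hs⟩
  · rintro B ⟨A, Z, x, y, hA, hZ, δ, h⟩
    obtain ⟨A₁, hA₁, hsA⟩ := hA.exists_cosyzygy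
    obtain ⟨Z₁, hZ₁, hsZ⟩ := hZ.exists_cosyzygy
    -- The cosyzygy step only shows that `Z₁` is orthogonal; orthogonality of `Z` itself needs a
    -- syzygy of `Z`.
    obtain ⟨_, -, hsZ'⟩ := hZ.exists_syzygy
    obtain ⟨B', Z', x', y', ⟨i⟩, hc, hs⟩ :=
      exists_cosyzygy_of_extension h hsA hsZ hsA.isExtOrthogonal hsZ'.isExtOrthogonal
    exact ⟨B', ⟨A₁, Z', x', y', hA₁, hZ₁.of_iso i, hc⟩, hs⟩

/-! ### Gorenstein projective dimension. -/

lemma GpdLE.succ {n : ℕ} {M : C} (h : T.GpdLE n M) : T.GpdLE (n + 1) M := by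
  induction n generalizing M with
  | zero =>
    exact ⟨0, M, 0, 𝟙 M, ⟨_, realizes_iso_right (isZero_zero C) (Iso.refl M)⟩, h,
      (IsProjective.of_isZero (isZero_zero C)).isGorensteinProjective⟩
  | succ n ih =>
    obtain ⟨N, G, x, y, hc, hG, hN⟩ := h
    exact ⟨N, G, x, y, hc, hG, ih hN⟩

lemma GpdLE.mono {m n : ℕ} (hmn : m ≤ n) {M : C} (h : T.GpdLE m M) : T.GpdLE n M := by
  induction hmn with
  | refl => exact h
  | step _ ih => exact ih.succ

variable (T) in
lemma gpd_le_iff (M : C) (n : ℕ) : T.gpd M ≤ n ↔ T.GpdLE n M := by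
  refine ⟨fun h => ?_, fun h => iInf₂_le n h⟩
  -- A strict bound on the infimum yields an actual witness.
  have h' : T.gpd M < (n + 1 : ℕ) := h.trans_lt (by exact_mod_cast Nat.lt_succ_self n)
  simp only [gpd, iInf_lt_iff] at h'
  obtain ⟨k, hk, hkn⟩ := h'
  exact hk.mono (Nat.lt_succ_iff.1 (by exact_mod_cast hkn))

lemma GpdLE.of_extension {n : ℕ} {A B Z : C} {x : A ⟶ B} {y : B ⟶ Z} (h : T.IsConflation x y)
    (hA : T.IsGorensteinProjective A) (hZ : T.GpdLE n Z) : T.GpdLE n B := by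
  cases n with
  | zero => exact IsGorensteinProjective.of_extension h hA hZ
  | succ n =>
    obtain ⟨δ, hδ⟩ := h
    obtain ⟨N, G, i, p, ⟨θ, hθ⟩, hG, hN⟩ := hZ
    -- `V` is an extension of `G` by `A`, and it covers `B` with the old kernel `N`.
    obtain ⟨V, m₁, e₂, m₂, e₁, hV₁, hV₂, -⟩ := realizes_pullback hδ hθ
    exact ⟨N, V, m₂, e₁, ⟨_, hV₂⟩, IsGorensteinProjective.of_extension ⟨_, hV₁⟩ hA hG, hN⟩

/-! ### Finite exact complexes and the induction. -/

namespace FiniteExactComplex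

/-- Splice a conflation `K ⟶ P ⟶ M` with an exact complex over `K`. -/
def cons {n : ℕ} {K P M : C} {x : K ⟶ P} {y : P ⟶ M} (h : T.IsConflation x y)
    (X : T.FiniteExactComplex n K) : T.FiniteExactComplex (n + 1) M where
  X i := i.casesOn P X.X
  d i := match i with
    | 0 => X.ε ≫ x
    | i + 1 => X.d i
  ε := y
  K i := i.casesOn K X.K
  g i := match i with
    | 0 => x
    | i + 1 => X.g i
  f i := match i with
    | 0 => X.ε
    | i + 1 => X.f i
  conflation_zero := h
  conflation_succ i := match i with
    | 0 => X.conflation_zero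
    | i + 1 => X.conflation_succ i
  d_eq i := match i with
    | 0 => rfl
    | i + 1 => X.d_eq i
  isZero_X i hi := match i with
    | 0 => absurd hi (by omega)
    | i + 1 => X.isZero_X i (by omega)
  isZero_K i hi := match i with
    | 0 => absurd hi (by omega)
    | i + 1 => X.isZero_K i (by omega)

/-- The exact complex over the first syzygy. -/
def tail {n : ℕ} {M : C} (X : T.FiniteExactComplex (n + 1) M) :
    T.FiniteExactComplex n (X.K 0) where
  X i := X.X (i + 1)
  d i := X.d (i + 1)
  ε := X.f 0
  K i := X.K (i + 1)
  g i := X.g (i + 1)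
  f i := X.f (i + 1)
  conflation_zero := X.conflation_succ 0
  conflation_succ i := X.conflation_succ (i + 1)
  d_eq i := X.d_eq (i + 1)
  isZero_X i hi := X.isZero_X (i + 1) (by omega)
  isZero_K i hi := X.isZero_K (i + 1) (by omega)

/-- Replace the conflation `K 0 ⟶ X 0 ⟶ M` by another one that starts at `K 0`. -/
def replaceHead {n : ℕ} {M P M' : C} (X : T.FiniteExactComplex n M) {x : X.K 0 ⟶ P} {y : P ⟶ M'}
    (h : T.IsConflation x y) : T.FiniteExactComplex n M' where
  X i := i.casesOn P fun i => X.X (i + 1)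
  d i := match i with
    | 0 => X.f 0 ≫ x
    | i + 1 => X.d (i + 1)
  ε := y
  K := X.K
  g i := match i with
    | 0 => x
    | i + 1 => X.g (i + 1)
  f := X.f
  conflation_zero := h
  conflation_succ i := X.conflation_succ i
  d_eq i := match i with
    | 0 => rfl
    | i + 1 => X.d_eq (i + 1)
  isZero_X i hi := match i with
    | 0 => absurd hi (by omega)
    | i + 1 => X.isZero_X (i + 1) hi
  isZero_K := X.isZero_K

variable (T) in
/-- The exact complex `0 ⟶ M ⟶ M ⟶ 0`. -/
noncomputable def single (M : C) : T.FiniteExactComplex 0 M where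
  X i := i.casesOn M fun _ => 0
  d _ := 0
  ε := 𝟙 M
  K _ := 0
  g _ := 0
  f _ := 0
  conflation_zero := ⟨_, realizes_iso_right (isZero_zero C) (Iso.refl M)⟩
  conflation_succ i := by
    have h := realizes_iso_right (T := T) (isZero_zero C) (Iso.refl (0 : C))
    rw [(isZero_zero C).eq_of_src (Iso.refl (0 : C)).hom 0] at h
    exact ⟨_, h⟩
  d_eq _ := by simp
  isZero_X i hi := match i with
    | 0 => absurd hi (by omega)
    | i + 1 => isZero_zero C
  isZero_K _ _ := isZero_zero C

lemma gpdLE {n : ℕ} {M : C} (X : T.FiniteExactComplex n M)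
    (hX : ∀ i ≤ n, T.IsGorensteinProjective (X.X i)) : T.GpdLE n M := by
  induction n generalizing M with
  | zero =>
    obtain ⟨δ, h⟩ := X.conflation_zero
    obtain ⟨e⟩ := h.nonempty_iso_of_isZero (X.isZero_K 0 le_rfl)
    exact (hX 0 le_rfl).of_iso e
  | succ n ih =>
    exact ⟨X.K 0, X.X 0, X.g 0, X.ε, X.conflation_zero, hX 0 (by omega),
      ih X.tail fun i hi => hX (i + 1) (by omega)⟩

end FiniteExactComplex

lemma GpdLE.exists_finiteExactComplex {n : ℕ} {M : C} (h : T.GpdLE n M) {s : ℕ} (hs : s ≤ n) :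
    ∃ X : T.FiniteExactComplex n M, T.IsGorensteinProjective (X.X s) ∧
      ∀ i : ℕ, i ≤ n → i ≠ s → T.IsProjective (X.X i) := by
  induction n generalizing M s with
  | zero =>
    obtain rfl : s = 0 := by omega
    exact ⟨.single T M, h, fun i hi hi' => absurd hi (by omega)⟩
  | succ n ih =>
    obtain ⟨K, G, x, y, ⟨δ, hδ⟩, hG, hK⟩ := h
    cases s with
    | zero =>
      obtain ⟨X, hX₀, hX⟩ := ih hK (Nat.zero_le n)
      obtain ⟨θ, hθ⟩ := X.conflation_zero
      obtain ⟨L, hL, hs⟩ := hX₀.exists_cosyzygy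
      obtain ⟨P, g, f, η, hP, hη, -⟩ := hs.exists_realizes
      -- `Y` is the cokernel of `X.K 0 ⟶ P`, so `P` can replace `X.X 0` in a complex that now
      -- resolves `Y`; moreover `Y` is an extension of `L` by `K`.
      obtain ⟨Y, d, e, _, k, δ'', rfl, -, -, hk, hde, -, -⟩ := T.et4 hθ hη
      -- `V` is an extension of `L` by `G` and becomes the term in degree zero, with kernel `Y` over
      -- `M`.
      obtain ⟨V, m₁, e₂, m₂, e₁, hV₁, hV₂, -⟩ := realizes_pushout hδ hde
      refine ⟨.cons ⟨_, hV₂⟩ (X.replaceHead ⟨_, hk⟩),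
        IsGorensteinProjective.of_extension ⟨_, hV₁⟩ hG hL, fun i hi hi' => ?_⟩
      match i with
      | 0 => exact absurd rfl hi'
      | 1 => exact hP
      | i + 2 => exact hX (i + 1) (by omega) (by omega)
    | succ s =>
      obtain ⟨L, hL, hs'⟩ := hG.exists_syzygy
      obtain ⟨P, g, f, η, hP, hη, -⟩ := hs'.exists_realizes
      -- `Y` is the kernel of `P ⟶ G ⟶ M` and an extension of `K` by `L`, so the induction
      -- hypothesis applies to it.
      obtain ⟨Y, d, e, k, _, δ'', rfl, -, -, hk, hde, -, -⟩ := T.et4_op hη hδ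
      obtain ⟨X, hXs, hX⟩ := ih (hK.of_extension ⟨_, hde⟩ hL) (s := s) (by omega)
      refine ⟨.cons ⟨_, hk⟩ X, hXs, fun i hi hi' => ?_⟩
      match i with
      | 0 => exact hP
      | i + 1 => exact hX i (by omega) (by omega)

end ExtriangulatedStructure

end Extri

theorem theorem3p10 {C : Type u} [Category.{v} C] [Preadditive C] [HasZeroObject C]
    [HasBinaryBiproducts C] (T : Extri.ExtriangulatedStructure.{w} C) (M : C) (n : ℕ) (hn : 1 ≤ n) :
    T.gpd M ≤ n ↔
      ∀ s : ℕ, s ≤ n →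
        ∃ X : T.FiniteExactComplex n M,
          T.IsGorensteinProjective (X.X s) ∧
          ∀ i : ℕ, i ≤ n → i ≠ s → T.IsProjective (X.X i) := by
  rw [T.gpd_le_iff]
  refine ⟨fun h s hs => h.exists_finiteExactComplex hs, fun h => ?_⟩
  obtain ⟨X, hX₀, hX⟩ := h 0 (Nat.zero_le n)
  refine X.gpdLE fun i hi => ?_
  rcases eq_or_ne i 0 with rfl | hi'
  · exact hX₀
  · exact (hX i hi hi').isGorensteinProjective
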